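/- All logarithms are to base 2. For a finite subset $Y$ of an abelian group $G$ and $m\in\mathbb N$ let $\mathcal F_Y(m)=\{A\subseteq Y : |A+A|\le m\}$, where $A+A=\{a+a' : a,a'\in A\}$, and for real $x\ge 1$ let $\beta_G(x)=\max\{|H| : H\le G,\ |H|\le x\}$ be the largest size of a finite subgroup of $G$ of size at most $x$. **Theorem 1.4.** Let $n,m\ge 1$ be integers, let $G$ be an abelian group and let $Y\subseteq G$ have $n$ elements. Put $\alpha=\left(\frac{\sqrt m}{\log n}\right)^{1/2}$ (if $n=1$, then $\alpha^{-2/3}$ is read as $0$) and $\beta=\beta_G\left(m+\alpha^{-2/3}m\right)$. Then $$|\mathcal F_Y(m)|\le\begin{cases}2^{(2+3\alpha)\sqrt m\,\log n+m} & \text{if } m\le(\log n)^2,\\[2pt] 2^{\frac{m+\beta}{2}+2^{13}\alpha^{-2/3}m} & \text{if } m>(\log n)^2.\end{cases}$$ In particular, let $m=m(n)\ge 1$ be an integer-valued function of $n$, with $\alpha=\alpha(n)$ and $\beta=\beta_G(m+\alpha^{-2/3}m)$ as above. If $m=o((\log n)^2)$ as $n\to\infty$, then $|\mathcal F_Y(m)|\le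 n^{(2+o(1))\sqrt m}$; if $(\log n)^2=o(m)$, then $|\mathcal F_Y(m)|\le 2^{\frac{m+\beta}{2}+o(m)}$. Both bounds hold for all sufficiently large $n$, every abelian group $G$ and every $n$-element subset $Y\subseteq G$, where the $o(1)$ and $o(m)$ terms depend only on the function $m(n)$ and not on $G$ or $Y$. -/

import Mathlib

open scoped Pointwise

universe u

/-- The family `F_Y(m)` of all subsets `A` of the finite set `Y` with `|A + A| ≤ m`. Since
`|A| ≤ |A + A|`, it is the union over `0 ≤ s ≤ m` of the subfamilies of sets of size `s`. -/
def smallSumsetFamily {G : Type u} [AddCommGroup G] [DecidableEq G] (Y : Finset G) (m : ℕ) :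
    Finset (Finset G) :=
  Y.powerset.filter fun A => (A + A).card ≤ m

/-- `β_G(x) = max {|H| : H ≤ G a finite subgroup with |H| ≤ x}`. For `x ≥ 1` the set below
is nonempty (trivial subgroup) and bounded, so that its supremum is a maximum. -/
noncomputable def subgroupBeta (G : Type u) [AddCommGroup G] (x : ℝ) : ℕ :=
  sSup {k : ℕ | (k : ℝ) ≤ x ∧ ∃ H : AddSubgroup G, Finite H ∧ Nat.card H = k}

/-- `α = (√m / log₂ n)^(1/2)`. (For `n = 1` the value is `0`, and so is that of `α ^ (-2/3)`,
which agrees with the reading `α = ∞`, `α ^ (-2/3) = 0`.) -/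
noncomputable def sumsetAlpha (n m : ℕ) : ℝ :=
  (√(m : ℝ) / Real.logb 2 (n : ℝ)) ^ (1 / 2 : ℝ)

/-! A set A in the family is described by a few chosen elements of Y, each costing a factor n, until
it is confined to a small container C; the remaining freedom costs 2^|C|. Along the way a known part
S of A + A is kept. Given T ⊆ A, as long as some a ∈ A moves more than `lam` elements of T out of S,
the translate a + T is added to S: one choice of a, a gain of more than `lam`. Since |S| ≤ m this
stops early, and then A lies in `absorbed S T C lam`, which double counting of the pairs (c, t) with
c + t ∈ S shows to be small (`card_filter_superset_le`, `card_absorbed_mul_le`).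

For m ≤ (log n)² one such run suffices, with |T| about (1 + α)√m and `lam` = √m: about (2 + α)√m
choices lead to a container of size at most m + m/α.

For m > (log n)² a first run gives |C| ≤ 2m, to be cut to about (m + β)/2. Let D be the set of
elements of C that move at least κ elements of C out of S. If A has k elements in D, a run with
these as T lowers m - |S| + |C| by at least κ/4, so there are few such rounds
(`card_absorbed_sub_le`, `card_sumsetFamily_le`). Otherwise A is a subset of C \ D together with
fewer than k further elements. Almost all sums from (C \ D) + C lie in S, so Pollard's theorem with
subgroup defect β forces |C \ D| ≤ (m + β)/2 + 2εm (`pollard_addCommGroup`,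
`card_le_of_card_escaping_le`). The choice ε = α^(-2/3) makes the cost of all choices O(εm) as well.
-/

/-- The number of representations `x = a + b` with `a ∈ A` and `b ∈ B`. -/
def repCount {G : Type u} [AddCommGroup G] [DecidableEq G] (A B : Finset G) (x : G) : ℕ :=
  (B.filter fun b => x - b ∈ A).card

/-! ### Representation counts and Pollard's theorem -/

section Pollard

variable {G : Type u} [AddCommGroup G] [DecidableEq G]

theorem repCount_le_card (A B : Finset G) (x : G) : repCount A B x ≤ B.card :=
  Finset.card_filter_le _ _

theorem repCount_mono_right (A : Finset G) {B B' : Finset G} (h : B ⊆ B') (x : G) :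
    repCount A B x ≤ repCount A B' x :=
  Finset.card_le_card (Finset.filter_subset_filter _ h)

theorem repCount_comm (A B : Finset G) (x : G) : repCount A B x = repCount B A x := by
  refine Finset.card_bij' (fun b _ => x - b) (fun a _ => x - a) ?_ ?_ ?_ ?_ <;>
    simp +contextual

theorem repCount_vadd_right (A B : Finset G) (e x : G) :
    repCount A (e +ᵥ B) (e + x) = repCount A B x := by
  refine Finset.card_bij' (fun b _ => -e + b) (fun b _ => e + b) ?_ ?_ ?_ ?_
  · intro b hb
    simp only [Finset.mem_filter, Finset.mem_vadd_finset, vadd_eq_add] at hb ⊢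
    obtain ⟨⟨c, hc, rfl⟩, h⟩ := hb
    simpa [hc] using h
  · intro b hb
    simp only [Finset.mem_filter, Finset.mem_vadd_finset, vadd_eq_add] at hb ⊢
    exact ⟨⟨b, hb.1, rfl⟩, by simpa using hb.2⟩
  · simp
  · simp

theorem repCount_union_right {A B B' : Finset G} (h : Disjoint B B') (x : G) :
    repCount A (B ∪ B') x = repCount A B x + repCount A B' x := by
  unfold repCount
  rw [Finset.filter_union, Finset.card_union_of_disjoint]
  exact Finset.disjoint_filter_filter h

theorem repCount_union_left {A A' B : Finset G} (h : Disjoint A A') (x : G) :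
    repCount (A ∪ A') B x = repCount A B x + repCount A' B x := by
  rw [repCount_comm, repCount_union_right h, repCount_comm, repCount_comm B A']

/-- The e-transform loses no representation: cutting A × B along A ∩ B, the only cell that changes
is (A ∩ B) × (B \ A), whose factors are swapped. -/
theorem repCount_union_inter_add_sdiff (A B : Finset G) (x : G) :
    repCount (A ∪ B) (A ∩ B) x + repCount (A \ B) (B \ A) x = repCount A B x := by
  have h1 : repCount A B x = repCount A (A ∩ B) x + repCount A (B \ A) x := by
    rw [← repCount_union_right (by rw [Finset.inter_comm]; exact (Finset.disjoint_sdiff_inter B A).symm)]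
    congr 1
    ext y; simp; tauto
  have h2 : repCount A (B \ A) x =
      repCount (A ∩ B) (B \ A) x + repCount (A \ B) (B \ A) x := by
    rw [← repCount_union_left (Finset.disjoint_sdiff_inter A B).symm]
    congr 1
    ext y; simp; tauto
  have h3 : repCount (A ∪ B) (A ∩ B) x = repCount A (A ∩ B) x + repCount (B \ A) (A ∩ B) x := by
    rw [← repCount_union_left Finset.disjoint_sdiff]
    congr 1
    ext y; simp
  have h4 := repCount_comm (A ∩ B) (B \ A) x
  omega

theorem sum_repCount_add (A B : Finset G) :
    ∑ x ∈ A + B, repCount A B x = B.card * A.card := by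
  unfold repCount
  have h := Finset.sum_card_bipartiteAbove_eq_sum_card_bipartiteBelow (s := A + B) (t := B)
    (fun x b => x - b ∈ A)
  unfold Finset.bipartiteAbove Finset.bipartiteBelow at h
  rw [h, Finset.sum_const_nat]
  intro b hb
  refine Finset.card_bij' (fun x _ => x - b) (fun a _ => a + b) ?_ ?_ ?_ ?_
  · simp +contextual
  · intro a ha
    simp [ha, Finset.add_mem_add ha hb]
  · simp
  · simp

/-- With only t elements of B in use, no count exceeds t, so truncation costs nothing and all t|A|
pairs are seen. -/
theorem mul_card_le_sum_min_repCount (A B : Finset G) {t : ℕ} (ht : t ≤ B.card) :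
    t * A.card ≤ ∑ x ∈ A + B, min (repCount A B x) t := by
  obtain ⟨B₀, hB, rfl⟩ := Finset.exists_subset_card_eq ht
  rw [← sum_repCount_add]
  calc ∑ x ∈ A + B₀, repCount A B₀ x ≤ ∑ x ∈ A + B₀, min (repCount A B x) B₀.card :=
        Finset.sum_le_sum fun x _ => le_min (repCount_mono_right A hB x) (repCount_le_card _ _ _)
    _ ≤ _ := Finset.sum_le_sum_of_subset (Finset.add_subset_add_left hB)

theorem sum_min_repCount_vadd_right (A B : Finset G) (e : G) (t : ℕ) :
    ∑ x ∈ A + (e +ᵥ B), min (repCount A (e +ᵥ B) x) t =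
      ∑ x ∈ A + B, min (repCount A B x) t := by
  have h : A + (e +ᵥ B) = e +ᵥ (A + B) := by
    rw [← Finset.singleton_vadd, ← Finset.singleton_vadd, vadd_eq_add, vadd_eq_add, add_left_comm]
  rw [h]
  symm
  refine Finset.sum_bij (fun x _ => e + x) ?_ ?_ ?_ ?_
  · intro x hx
    exact Finset.vadd_mem_vadd_finset (a := e) hx
  · simp
  · intro y hy
    obtain ⟨x, hx, rfl⟩ := Finset.mem_vadd_finset.1 hy
    exact ⟨x, hx, rfl⟩
  · intro x hx
    rw [repCount_vadd_right]

/-- If every translate of `B` that meets `A` lies in `A`, then `B` is no larger than some finite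
subgroup which is itself no larger than `A`. -/
theorem exists_addSubgroup_of_translates_subset {A B : Finset G} (hA : A.Nonempty)
    (hB : B.Nonempty) (h : ∀ a ∈ A, ∀ b ∈ B, (a - b) +ᵥ B ⊆ A) :
    ∃ H : AddSubgroup G, Finite H ∧ B.card ≤ Nat.card H ∧ Nat.card H ≤ A.card := by
  obtain ⟨a₀, ha₀⟩ := hA
  obtain ⟨b₀, hb₀⟩ := hB
  set H : AddSubgroup G := AddAction.stabilizer G A with hH
  have hmem : ∀ g : H, (g : G) + a₀ ∈ A := by
    intro g
    have hg : (g : G) +ᵥ A = A := g.2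
    have := Finset.vadd_mem_vadd_finset (a := (g : G)) ha₀
    rwa [hg] at this
  let f : H → A := fun g => ⟨(g : G) + a₀, hmem g⟩
  have hf : Function.Injective f := by
    intro g g' hgg
    have := congrArg Subtype.val hgg
    exact Subtype.ext (by simpa [f] using this)
  have hfin : Finite H := Finite.of_injective f hf
  refine ⟨H, hfin, ?_, ?_⟩
  -- Here (b - b₀) + a = (a - b₀) + b lies in A, so b - b₀ maps A into itself, hence onto itself by
  -- finiteness.
  · have hsub : ∀ b : B, (b : G) - b₀ ∈ H := by
      intro b
      rw [hH, AddAction.mem_stabilizer_iff]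
      refine Finset.eq_of_subset_of_card_le ?_ (by simp)
      intro y hy
      obtain ⟨a, ha, rfl⟩ := Finset.mem_vadd_finset.1 hy
      have := h a ha b₀ hb₀ (Finset.vadd_mem_vadd_finset (a := a - b₀) b.2)
      convert this using 1
      simp only [vadd_eq_add]; abel
    have := Nat.card_le_card_of_injective (fun b : B => (⟨(b : G) - b₀, hsub b⟩ : H)) (by
      intro b b' hb
      have := congrArg Subtype.val hb
      exact Subtype.ext (by simpa using this))
    simpa using this
  · simpa using Nat.card_le_card_of_injective f hf

/-- Pollard's theorem in abelian groups: `β` bounds the sizes of the finite subgroups of size at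
most `X`. -/
theorem pollard_addCommGroup (X β : ℝ)
    (hβ : ∀ H : AddSubgroup G, Finite H → (Nat.card H : ℝ) ≤ X → (Nat.card H : ℝ) ≤ β)
    (A B : Finset G) (t : ℕ) (htA : t ≤ A.card) (htB : t ≤ B.card) (hβ0 : 0 ≤ β) :
    (t : ℝ) * min X (A.card + B.card - t - β) ≤
      ((∑ x ∈ A + B, min (repCount A B x) t : ℕ) : ℝ) := by
  induction hN : B.card using Nat.strong_induction_on generalizing A B t with
  | _ N ih =>
  subst hN
  rcases Nat.eq_zero_or_pos t with rfl | ht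
  · simp
  have hAn : A.Nonempty := Finset.card_pos.1 (by omega)
  have hBn : B.Nonempty := Finset.card_pos.1 (by omega)
  have htr : (0 : ℝ) ≤ t := Nat.cast_nonneg t
  -- In the subgroup case the trivial bound t|A| is enough: either X ≤ |A|, or |H| ≤ X and so |B| ≤
  -- |H| ≤ β.
  by_cases hst : ∀ a ∈ A, ∀ b ∈ B, (a - b) +ᵥ B ⊆ A
  · obtain ⟨H, hfin, hBH, hHA⟩ := exists_addSubgroup_of_translates_subset hAn hBn hst
    have h1 : ((t * A.card : ℕ) : ℝ) ≤ ((∑ x ∈ A + B, min (repCount A B x) t : ℕ) : ℝ) :=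
      Nat.cast_le.2 (mul_card_le_sum_min_repCount A B htB)
    refine le_trans ?_ h1
    push_cast
    refine mul_le_mul_of_nonneg_left ?_ htr
    rcases le_total X A.card with hX | hX
    · exact (min_le_left _ _).trans hX
    · have hHA' : (Nat.card H : ℝ) ≤ A.card := by exact_mod_cast hHA
      have h2 := hβ H hfin (hHA'.trans hX)
      have h3 : (B.card : ℝ) ≤ Nat.card H := by exact_mod_cast hBH
      exact (min_le_right _ _).trans (by linarith)
  · push Not at hst
    -- Otherwise B is replaced by a translate D that meets A without lying in A, so that both A ∩ D
    -- and D \ A are smaller than D.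
    obtain ⟨a, ha, b, hb, hsub⟩ := hst
    rw [← sum_min_repCount_vadd_right A B (a - b) t]
    have hcard : ((a - b) +ᵥ B).card = B.card := Finset.card_vadd_finset _ _
    have haB : a ∈ (a - b) +ᵥ B := by
      have := Finset.vadd_mem_vadd_finset (a := a - b) hb
      simpa using this
    rw [← hcard] at ih htB ⊢
    generalize (a - b) +ᵥ B = D at *
    have hu : (A ∩ D).card + (A \ D).card = A.card := Finset.card_inter_add_card_sdiff A D
    have hu' : (A ∩ D).card + (D \ A).card = D.card := by
      rw [Finset.inter_comm]; exact Finset.card_inter_add_card_sdiff D A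
    have hU : (A ∪ D).card + (A ∩ D).card = A.card + D.card := Finset.card_union_add_card_inter A D
    have hupos : 0 < (A ∩ D).card := Finset.card_pos.2 ⟨a, Finset.mem_inter.2 ⟨ha, haB⟩⟩
    have hDpos : 0 < (D \ A).card := Finset.card_pos.2 (Finset.sdiff_nonempty.2 hsub)
    have hUI : (A ∪ D) + (A ∩ D) ⊆ A + D := Finset.union_add_inter_subset
    have hsd : (A \ D) + (D \ A) ⊆ A + D :=
      Finset.add_subset_add Finset.sdiff_subset Finset.sdiff_subset
    have hUr : ((A ∪ D).card : ℝ) + (A ∩ D).card = A.card + D.card := by exact_mod_cast hU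
    rcases le_or_gt t (A ∩ D).card with htu | htu
    · have h1 := ih (A ∩ D).card (by omega) (A ∪ D) (A ∩ D) t (by omega) htu rfl
      have h2 : ∑ x ∈ (A ∪ D) + (A ∩ D), min (repCount (A ∪ D) (A ∩ D) x) t ≤
          ∑ x ∈ A + D, min (repCount A D x) t := by
        refine le_trans (Finset.sum_le_sum fun x _ => ?_) (Finset.sum_le_sum_of_subset hUI)
        have := repCount_union_inter_add_sdiff A D x
        exact min_le_min (by omega) le_rfl
      rw [hUr] at h1
      exact h1.trans (Nat.cast_le.2 h2)
    -- The level t is split as u + (t - u): the trivial bound at level u for the pair (A ∪ D, A ∩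
    -- D), induction at level t - u for (A \ D, D \ A).
    · set u := (A ∩ D).card with hudef
      have h1 := mul_card_le_sum_min_repCount (A ∪ D) (A ∩ D) (t := u) le_rfl
      have h2 := ih (D \ A).card (by omega) (A \ D) (D \ A) (t - u) (by omega) (by omega) rfl
      have h3 : ∑ x ∈ (A ∪ D) + (A ∩ D), min (repCount (A ∪ D) (A ∩ D) x) u +
          ∑ x ∈ (A \ D) + (D \ A), min (repCount (A \ D) (D \ A) x) (t - u) ≤
          ∑ x ∈ A + D, min (repCount A D x) t := by
        refine le_trans (add_le_add (Finset.sum_le_sum_of_subset hUI)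
          (Finset.sum_le_sum_of_subset hsd)) ?_
        rw [← Finset.sum_add_distrib]
        refine Finset.sum_le_sum fun x _ => ?_
        have := repCount_union_inter_add_sdiff A D x
        omega
      have h1' : (u : ℝ) * (A ∪ D).card ≤ ((∑ x ∈ (A ∪ D) + (A ∩ D),
        min (repCount (A ∪ D) (A ∩ D) x) u : ℕ) : ℝ) := by exact_mod_cast h1
      have h3' := (Nat.cast_le (α := ℝ)).2 h3
      rw [Nat.cast_add] at h3'
      refine le_trans ?_ h3'
      refine le_trans ?_ (add_le_add h1' h2)
      have e1 : ((A ∪ D).card : ℝ) = A.card + D.card - u := by linarith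
      have e2 : ((A \ D).card : ℝ) = A.card - u := by
        have : (u : ℝ) + (A \ D).card = A.card := by exact_mod_cast hu
        linarith
      have e3 : ((D \ A).card : ℝ) = D.card - u := by
        have : (u : ℝ) + (D \ A).card = D.card := by exact_mod_cast hu'
        linarith
      have e4 : ((t - u : ℕ) : ℝ) = t - u := Nat.cast_sub htu.le
      have hur : (0 : ℝ) ≤ u := Nat.cast_nonneg u
      have htu' : (0 : ℝ) ≤ t - u := by rw [← e4]; exact Nat.cast_nonneg _
      rw [e1, e2, e3, e4]
      rcases le_total X ((A.card : ℝ) - u + (D.card - u) - (t - u) - β) with hX | hX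
      · rw [min_eq_left hX]
        have : (t : ℝ) * min X (A.card + D.card - t - β) ≤ t * X :=
          mul_le_mul_of_nonneg_left (min_le_left _ _) htr
        have h4 : (u : ℝ) * X ≤ u * (A.card + D.card - u) :=
          mul_le_mul_of_nonneg_left (by linarith) hur
        linarith
      · rw [min_eq_right hX]
        have : (t : ℝ) * min X (A.card + D.card - t - β) ≤ t * (A.card + D.card - t - β) :=
          mul_le_mul_of_nonneg_left (min_le_right _ _) htr
        -- The two sides differ by exactly uβ.
        nlinarith [mul_nonneg hur hβ0]

/-- Bounding the truncated representation counts through the sums that avoid a set `S`. -/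
theorem sum_min_repCount_le (A B S : Finset G) (t : ℕ) :
    ∑ x ∈ A + B, min (repCount A B x) t ≤
      t * S.card + ∑ a ∈ A, (B.filter fun b => a + b ∉ S).card := by
  have h1 : ∑ x ∈ (A + B) ∩ S, min (repCount A B x) t ≤ t * S.card := by
    calc _ ≤ ∑ x ∈ (A + B) ∩ S, t := Finset.sum_le_sum fun x _ => min_le_right _ _
      _ = ((A + B) ∩ S).card * t := by simp
      _ ≤ t * S.card := by
        rw [mul_comm]; exact Nat.mul_le_mul_left _ (Finset.card_le_card Finset.inter_subset_right)
  have h2 : ∑ x ∈ (A + B) \ S, min (repCount A B x) t ≤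
      ∑ a ∈ A, (B.filter fun b => a + b ∉ S).card := by
    calc _ ≤ ∑ x ∈ (A + B) \ S, repCount A B x := Finset.sum_le_sum fun x _ => min_le_left _ _
      _ = ∑ x ∈ (A + B) \ S, (A.filter fun a => x - a ∈ B).card :=
        Finset.sum_congr rfl fun x _ => repCount_comm A B x
      _ = ∑ a ∈ A, (((A + B) \ S).filter fun x => x - a ∈ B).card := by
        have h := Finset.sum_card_bipartiteAbove_eq_sum_card_bipartiteBelow (s := (A + B) \ S)
          (t := A) (fun x a => x - a ∈ B)
        exact h
      _ ≤ _ := by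
        refine Finset.sum_le_sum fun a _ => ?_
        refine Finset.card_le_card_of_injOn (fun x => x - a) ?_ ?_
        · intro x hx
          simp only [Finset.coe_filter, Finset.mem_sdiff, Set.mem_ofPred_eq] at hx ⊢
          exact ⟨hx.2, by simpa using hx.1.2⟩
        · intro x _ y _ hxy
          simpa using hxy
  rw [← Finset.sum_inter_add_sum_sdiff (A + B) S]
  omega

end Pollard

/-! ### Greedy growth of the known sumset and absorption -/

section Absorption

variable {G : Type u} [AddCommGroup G] [DecidableEq G]

/-- The sets `A ⊆ C` with `|A + A| ≤ m` and `S ⊆ A + A`. -/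
def sumsetFamily (m : ℕ) (S C : Finset G) : Finset (Finset G) :=
  C.powerset.filter fun A => (A + A).card ≤ m ∧ S ⊆ A + A

/-- The elements of `T` that are translated by `c` to an element outside of `S`. -/
def escaping (S T : Finset G) (c : G) : Finset G :=
  T.filter fun t => c + t ∉ S

/-- The elements of `C` by which at most `lam` elements of `T` are translated out of `S`. -/
noncomputable def absorbed (S T C : Finset G) (lam : ℝ) : Finset G :=
  C.filter fun c => ((escaping S T c).card : ℝ) ≤ lam

theorem mem_sumsetFamily {m : ℕ} {S C A : Finset G} :
    A ∈ sumsetFamily m S C ↔ A ⊆ C ∧ (A + A).card ≤ m ∧ S ⊆ A + A := by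
  simp [sumsetFamily]

theorem sumsetFamily_card_le_two_pow (m : ℕ) (S C : Finset G) :
    (sumsetFamily m S C).card ≤ 2 ^ C.card := by
  rw [← Finset.card_powerset]; exact Finset.card_filter_le _ _

theorem card_union_image_add (S T : Finset G) (a : G) :
    (S ∪ T.image (a + ·)).card = S.card + (escaping S T a).card := by
  have : S ∪ T.image (a + ·) = S ∪ (escaping S T a).image (a + ·) := by
    ext x
    simp only [escaping, Finset.mem_union, Finset.mem_image, Finset.mem_filter]
    constructor
    · rintro (h | ⟨t, ht, rfl⟩)
      · exact Or.inl h
      · by_cases h : a + t ∈ S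
        · exact Or.inl h
        · exact Or.inr ⟨t, ⟨ht, h⟩, rfl⟩
    · rintro (h | ⟨t, ht, rfl⟩)
      · exact Or.inl h
      · exact Or.inr ⟨t, ht.1, rfl⟩
  rw [this, Finset.card_union_of_disjoint, Finset.card_image_of_injective _ (add_right_injective a)]
  rw [Finset.disjoint_right]
  simp only [escaping, Finset.mem_image, Finset.mem_filter]
  rintro _ ⟨t, ht, rfl⟩
  exact ht.2

/-- Counting sets that contain `T` by greedily enlarging the known part `S` of the sumset: as long
as some `a ∈ A` translates more than `lam` elements of `T` out of `S`, add `a + T` to `S`. -/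
theorem card_filter_superset_le {m : ℕ} {C T : Finset G} {lam : ℝ} (hlam : 0 ≤ lam)
    {η w : ℕ → ℝ} (hw : ∀ s ≤ m, η s ≤ w s)
    (hstep : ∀ s s' : ℕ, (s : ℝ) + lam < s' → s' ≤ m → C.card * w s' ≤ w s - η s)
    (S : Finset G) (hS : S.card ≤ m)
    (hη : ∀ S' : Finset G, S ⊆ S' → S'.card ≤ m →
      ((sumsetFamily m S' (absorbed S' T C lam)).card : ℝ) ≤ η S'.card) :
    (((sumsetFamily m S C).filter (T ⊆ ·)).card : ℝ) ≤ w S.card := by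
  induction hd : m - S.card using Nat.strong_induction_on generalizing S with
  | _ d ih =>
  subst hd
  set bad : Finset G := C.filter fun c => lam < (escaping S T c).card with hbad
  have hsub : (sumsetFamily m S C).filter (T ⊆ ·) ⊆
      sumsetFamily m S (absorbed S T C lam) ∪
        bad.biUnion fun a => (sumsetFamily m (S ∪ T.image (a + ·)) C).filter (T ⊆ ·) := by
    intro A hA
    rw [Finset.mem_filter, mem_sumsetFamily] at hA
    obtain ⟨⟨hAC, hAm, hSA⟩, hTA⟩ := hA
    rw [Finset.mem_union, Finset.mem_biUnion]
    by_cases h : ∃ a ∈ A, lam < (escaping S T a).card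
    · obtain ⟨a, ha, hla⟩ := h
      refine Or.inr ⟨a, Finset.mem_filter.2 ⟨hAC ha, hla⟩, ?_⟩
      rw [Finset.mem_filter, mem_sumsetFamily]
      refine ⟨⟨hAC, hAm, Finset.union_subset hSA ?_⟩, hTA⟩
      exact Finset.image_subset_iff.2 fun t ht => Finset.add_mem_add ha (hTA ht)
    · push Not at h
      refine Or.inl (mem_sumsetFamily.2 ⟨fun a ha => ?_, hAm, hSA⟩)
      exact Finset.mem_filter.2 ⟨hAC ha, h a ha⟩
  have hbadC : bad.card ≤ C.card := Finset.card_filter_le _ _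
  have hwη := sub_nonneg.2 (hw S.card hS)
  have hterm : ∀ a ∈ bad, (((sumsetFamily m (S ∪ T.image (a + ·)) C).filter (T ⊆ ·)).card : ℝ) ≤
      (w S.card - η S.card) / C.card := by
    intro a ha
    have hCpos : (0 : ℝ) < C.card :=
      Nat.cast_pos.2 (Finset.card_pos.2 ⟨a, (Finset.mem_filter.1 ha).1⟩)
    have hla : lam < (escaping S T a).card := (Finset.mem_filter.1 ha).2
    have hc := card_union_image_add S T a
    have hpos : 0 < (escaping S T a).card := by exact_mod_cast hlam.trans_lt hla
    rw [le_div_iff₀ hCpos]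
    by_cases hm : (S ∪ T.image (a + ·)).card ≤ m
    · have h1 := ih _ (by omega) (S ∪ T.image (a + ·)) hm
        (fun S' h => hη S' (Finset.subset_union_left.trans h)) rfl
      have h2 := hstep S.card _ (by rw [hc]; push_cast; linarith) hm
      nlinarith
    · have : (sumsetFamily m (S ∪ T.image (a + ·)) C).filter (T ⊆ ·) = ∅ := by
        refine Finset.eq_empty_of_forall_notMem fun A hA => hm ?_
        rw [Finset.mem_filter, mem_sumsetFamily] at hA
        exact (Finset.card_le_card hA.1.2.2).trans hA.1.2.1
      rw [this]
      simpa using hwη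
  have h1 : (((sumsetFamily m S C).filter (T ⊆ ·)).card : ℝ) ≤
      (sumsetFamily m S (absorbed S T C lam)).card +
        ∑ a ∈ bad, (((sumsetFamily m (S ∪ T.image (a + ·)) C).filter (T ⊆ ·)).card : ℝ) := by
    have := (Finset.card_le_card hsub).trans
      ((Finset.card_union_le _ _).trans (Nat.add_le_add_left Finset.card_biUnion_le _))
    exact_mod_cast this
  have h2 := Finset.sum_le_card_nsmul bad _ _ hterm
  have h3 := hη S subset_rfl hS
  have h4 : (bad.card : ℝ) * ((w S.card - η S.card) / C.card) ≤ w S.card - η S.card := by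
    rcases Nat.eq_zero_or_pos C.card with h0 | h0
    · have : bad.card = 0 := by omega
      simp only [this]; simpa using hwη
    · have hCpos : (0 : ℝ) < C.card := by exact_mod_cast h0
      have h5 : (bad.card : ℝ) ≤ C.card := by exact_mod_cast hbadC
      calc (bad.card : ℝ) * ((w S.card - η S.card) / C.card)
          ≤ C.card * ((w S.card - η S.card) / C.card) :=
            mul_le_mul_of_nonneg_right h5 (div_nonneg hwη hCpos.le)
        _ = _ := mul_div_cancel₀ _ hCpos.ne'
  rw [nsmul_eq_mul] at h2
  linarith

theorem sum_card_escaping_comm (S T C : Finset G) :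
    ∑ c ∈ C, (escaping S T c).card = ∑ t ∈ T, (escaping S C t).card := by
  have h := Finset.sum_card_bipartiteAbove_eq_sum_card_bipartiteBelow (s := C) (t := T)
    (fun c t => c + t ∉ S)
  unfold Finset.bipartiteAbove Finset.bipartiteBelow at h
  unfold escaping
  rw [h]
  simp_rw [add_comm]

/-- Both sides are sizes of unions S ∪ (t + C), which grow with S: enlarging S by q lowers the
number of escaping elements by at most q. -/
theorem card_escaping_le_add {S S' : Finset G} (h : S ⊆ S') (C : Finset G) (t : G) :
    (escaping S C t).card + S.card ≤ (escaping S' C t).card + S'.card := by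
  have h1 := card_union_image_add S C t
  have h2 := card_union_image_add S' C t
  have h3 := Finset.card_le_card (Finset.union_subset_union_left (t := C.image (t + ·)) h)
  omega

theorem absorbed_subset (S T C : Finset G) (lam : ℝ) : absorbed S T C lam ⊆ C :=
  Finset.filter_subset _ _

/-- Few elements can be absorbed by a small set. -/
theorem card_absorbed_mul_le (S T C : Finset G) (lam : ℝ) :
    (T.card - lam) * (absorbed S T C lam).card ≤ T.card * S.card := by
  set D := absorbed S T C lam
  have h1 : ∀ c ∈ D, (T.card : ℝ) - lam ≤ ((T.filter fun t => c + t ∈ S).card : ℝ) := by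
    intro c hc
    have h2 : ((escaping S T c).card : ℝ) ≤ lam := (Finset.mem_filter.1 hc).2
    have h3 := Finset.card_filter_add_card_filter_not (s := T) (fun t => c + t ∈ S)
    have h4 : ((T.filter fun t => c + t ∈ S).card : ℝ) + (escaping S T c).card = T.card := by
      exact_mod_cast h3
    linarith
  have h2 := Finset.card_nsmul_le_sum D _ _ h1
  have h3 : ∑ c ∈ D, (T.filter fun t => c + t ∈ S).card ≤ T.card * S.card := by
    have h := Finset.sum_card_bipartiteAbove_eq_sum_card_bipartiteBelow (s := D) (t := T)
      (fun c t => c + t ∈ S)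
    unfold Finset.bipartiteAbove Finset.bipartiteBelow at h
    rw [h]
    refine (Finset.sum_le_card_nsmul T _ S.card fun t _ => ?_).trans (by simp)
    refine Finset.card_le_card_of_injOn (fun c => c + t) ?_ ?_
    · intro c hc
      exact (Finset.mem_filter.1 hc).2
    · intro x _ y _ hxy
      simpa using hxy
  have h4 : ((∑ c ∈ D, (T.filter fun t => c + t ∈ S).card : ℕ) : ℝ) ≤ T.card * S.card := by
    exact_mod_cast h3
  rw [nsmul_eq_mul] at h2
  push_cast at h4
  linarith

/-- If every element of `T` translates many elements of `C` out of `S`, then absorbing `T` either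
enlarges `S` or shrinks `C`. -/
theorem card_absorbed_sub_le {S S' T C : Finset G} {lam κ : ℝ} (hS : S ⊆ S')
    (hT : 0 < T.card) (hlam : 2 * (lam * C.card) ≤ T.card * κ) (hκ : 0 ≤ κ)
    (hesc : ∀ t ∈ T, κ ≤ (escaping S C t).card) :
    ((absorbed S' T C lam).card : ℝ) - S'.card ≤ C.card - S.card - κ / 4 := by
  set D := absorbed S' T C lam with hD
  have hDC : D ⊆ C := absorbed_subset _ _ _ _
  have hDCr : (D.card : ℝ) ≤ C.card := by exact_mod_cast Finset.card_le_card hDC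
  have hTr : (0 : ℝ) < T.card := by exact_mod_cast hT
  -- If S grew by less than κ/4, at least (3/4)κ|T| pairs still escape S'. Absorbed elements account
  -- for at most κ|T|/2 of them, and every other element of C for at most |T|, so at least κ/4
  -- elements are lost.
  rcases le_total ((S.card : ℝ) + κ / 4) S'.card with hq | hq
  · linarith
  have hSS : (S.card : ℝ) ≤ S'.card := by exact_mod_cast Finset.card_le_card hS
  have h1 : ∀ t ∈ T, 3 / 4 * κ ≤ ((escaping S' C t).card : ℝ) := by
    intro t ht
    have h2 : ((escaping S C t).card : ℝ) + S.card ≤ (escaping S' C t).card + S'.card := by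
      exact_mod_cast card_escaping_le_add hS C t
    have := hesc t ht
    linarith
  have h2 := Finset.card_nsmul_le_sum T _ _ h1
  have h3 : ((∑ c ∈ C, (escaping S' T c).card : ℕ) : ℝ) =
      ((∑ t ∈ T, (escaping S' C t).card : ℕ) : ℝ) := by rw [sum_card_escaping_comm]
  push_cast at h3
  rw [← h3, ← Finset.sum_sdiff hDC, nsmul_eq_mul] at h2
  have h4 : ∑ c ∈ D, ((escaping S' T c).card : ℝ) ≤ D.card * lam := by
    rw [← nsmul_eq_mul]
    exact Finset.sum_le_card_nsmul D _ _ fun c hc => (Finset.mem_filter.1 hc).2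
  have h5 : ∑ c ∈ C \ D, ((escaping S' T c).card : ℝ) ≤ (C \ D).card * T.card := by
    rw [← nsmul_eq_mul]
    refine Finset.sum_le_card_nsmul _ _ _ fun c _ => ?_
    exact_mod_cast Finset.card_filter_le _ _
  have h6 : ((C \ D).card : ℝ) = C.card - D.card := by
    rw [Finset.card_sdiff_of_subset hDC, Nat.cast_sub (Finset.card_le_card hDC)]
  rw [h6] at h5
  have hDlam : (D.card : ℝ) * lam ≤ T.card * κ / 2 := by
    rcases le_total 0 lam with h0 | h0
    · nlinarith
    · nlinarith [Nat.cast_nonneg (α := ℝ) D.card]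
  have h7 : (T.card : ℝ) * (κ / 4) ≤ T.card * (C.card - D.card) := by nlinarith
  have h8 := le_of_mul_le_mul_left h7 hTr
  linarith

/-- The number of subsets with fewer than `k` elements. -/
theorem card_powerset_filter_card_lt_le {α : Type*} (Y : Finset α) (hY : 2 ≤ Y.card) (k : ℕ) :
    (Y.powerset.filter fun A => A.card < k).card ≤ Y.card ^ k := by
  classical
  calc (Y.powerset.filter fun A => A.card < k).card
      ≤ ((Finset.range k).biUnion fun i => Y.powersetCard i).card := by
        refine Finset.card_le_card fun A hA => ?_
        rw [Finset.mem_filter, Finset.mem_powerset] at hA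
        rw [Finset.mem_biUnion]
        exact ⟨A.card, Finset.mem_range.2 hA.2, Finset.mem_powersetCard.2 ⟨hA.1, rfl⟩⟩
    _ ≤ ∑ i ∈ Finset.range k, (Y.powersetCard i).card := Finset.card_biUnion_le
    _ ≤ ∑ i ∈ Finset.range k, Y.card ^ i := Finset.sum_le_sum fun i _ => by
        rw [Finset.card_powersetCard]; exact Nat.choose_le_pow _ _
    _ ≤ Y.card ^ k := (Nat.geomSum_lt hY (n := k) (by simp)).le

/-- Sets that meet `D` in at least `k` points, counted by a `k`-subset of the intersection. -/
theorem card_filter_le_inter_le {α : Type*} [DecidableEq α] (F : Finset (Finset α))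
    (D : Finset α) (k n : ℕ) (hn : D.card ≤ n) {b : ℝ} (hb : 0 ≤ b)
    (h : ∀ T ∈ D.powersetCard k, ((F.filter (T ⊆ ·)).card : ℝ) ≤ b) :
    ((F.filter fun A => k ≤ (A ∩ D).card).card : ℝ) ≤ (n : ℝ) ^ k * b := by
  have hsub : (F.filter fun A => k ≤ (A ∩ D).card) ⊆
      (D.powersetCard k).biUnion fun T => F.filter (T ⊆ ·) := by
    intro A hA
    rw [Finset.mem_filter] at hA
    obtain ⟨T, hT, hTk⟩ := Finset.exists_subset_card_eq hA.2
    rw [Finset.mem_biUnion]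
    exact ⟨T, Finset.mem_powersetCard.2 ⟨hT.trans Finset.inter_subset_right, hTk⟩,
      Finset.mem_filter.2 ⟨hA.1, hT.trans Finset.inter_subset_left⟩⟩
  have h1 : ((F.filter fun A => k ≤ (A ∩ D).card).card : ℝ) ≤
      ∑ T ∈ D.powersetCard k, ((F.filter (T ⊆ ·)).card : ℝ) := by
    exact_mod_cast (Finset.card_le_card hsub).trans Finset.card_biUnion_le
  have h2 := Finset.sum_le_card_nsmul _ _ _ h
  rw [nsmul_eq_mul, Finset.card_powersetCard] at h2
  have h3 : ((D.card.choose k : ℕ) : ℝ) ≤ (n : ℝ) ^ k := by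
    exact_mod_cast (Nat.choose_le_pow _ _).trans (Nat.pow_le_pow_left hn k)
  exact h1.trans (h2.trans (mul_le_mul_of_nonneg_right h3 hb))

/-- Sets that meet `D` in fewer than `k` points, counted by the intersection and the rest. -/
theorem card_filter_inter_lt_le {α : Type*} [DecidableEq α] (F : Finset (Finset α))
    (C D Y : Finset α) (hF : ∀ A ∈ F, A ⊆ C) (hD : D ⊆ Y) (hY : 2 ≤ Y.card) (k : ℕ) :
    (F.filter fun A => (A ∩ D).card < k).card ≤ Y.card ^ k * 2 ^ (C \ D).card := by
  rw [← Finset.card_powerset]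
  refine le_trans ?_ (Nat.mul_le_mul_right _ (card_powerset_filter_card_lt_le Y hY k))
  rw [← Finset.card_product]
  refine Finset.card_le_card_of_injOn (fun A => (A ∩ D, A \ D)) ?_ ?_
  · intro A hA
    have hA' := Finset.mem_filter.1 (Finset.mem_coe.1 hA)
    simp only [Finset.mem_coe, Finset.mem_product, Finset.mem_filter, Finset.mem_powerset]
    exact ⟨⟨Finset.inter_subset_right.trans hD, hA'.2⟩, Finset.sdiff_subset_sdiff (hF A hA'.1) le_rfl⟩
  · intro A _ B _ hAB
    simp only [Prod.mk.injEq] at hAB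
    rw [← Finset.sdiff_union_inter A D, hAB.1, hAB.2, Finset.sdiff_union_inter]

end Absorption

/-! ### Container recursion for large m -/

section LargeSumset

variable {G : Type u} [AddCommGroup G] [DecidableEq G]

/-- Sets all of whose elements translate few elements of `C ⊇ D` out of `S` are small. -/
theorem card_le_of_card_escaping_le {m : ℕ} {ε β : ℝ} (hε : 0 < ε) (hεm : 1 ≤ ε * m) (hβ0 : 0 ≤ β)
    (hβ : ∀ H : AddSubgroup G, Finite H → (Nat.card H : ℝ) ≤ m + ε * m → (Nat.card H : ℝ) ≤ β)
    {S C D : Finset G} (hDC : D ⊆ C) (hS : S.card ≤ m) (hC : (C.card : ℝ) ≤ 2 * m)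
    (hesc : ∀ c ∈ D, ((escaping S C c).card : ℝ) ≤ ε ^ 2 / 4 * m) :
    (D.card : ℝ) ≤ (m + β) / 2 + 2 * ε * m := by
  set t := ⌈ε * m⌉₊ with ht
  have ht1 : ε * m ≤ t := Nat.le_ceil _
  have ht2 : (t : ℝ) < ε * m + 1 := Nat.ceil_lt_add_one (by linarith)
  have hm0 : (0 : ℝ) ≤ m := Nat.cast_nonneg m
  by_contra! hlt
  have htD : t ≤ D.card := by
    have : (t : ℝ) ≤ D.card := by linarith
    exact_mod_cast this
  have hDCc := Finset.card_le_card hDC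
  have hDCr : (D.card : ℝ) ≤ C.card := by exact_mod_cast hDCc
  have hSr : (S.card : ℝ) ≤ m := by exact_mod_cast hS
  have h1 := pollard_addCommGroup (m + ε * m) β hβ D C t htD (htD.trans hDCc) hβ0
  have h2 : ((∑ x ∈ D + C, min (repCount D C x) t : ℕ) : ℝ) ≤
      t * S.card + ∑ c ∈ D, ((escaping S C c).card : ℝ) := by
    exact_mod_cast sum_min_repCount_le D C S t
  have h3 := Finset.sum_le_card_nsmul D _ _ hesc
  rw [nsmul_eq_mul] at h3
  -- The escaping sums number at most 2m · ε²m/4 = (εm)²/2 ≤ t · εm/2, as t ≥ εm.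
  have h4 : (t : ℝ) * min (m + ε * m) (D.card + C.card - t - β) ≤ t * (m + ε * m / 2) := by
    have h5 : (D.card : ℝ) * (ε ^ 2 / 4 * m) ≤ 2 * m * (ε ^ 2 / 4 * m) :=
      mul_le_mul_of_nonneg_right (hDCr.trans hC) (by positivity)
    have h6 : (t : ℝ) * S.card ≤ t * m := mul_le_mul_of_nonneg_left hSr (Nat.cast_nonneg t)
    have h7 : ε * m * (ε * m) ≤ t * (ε * m) := mul_le_mul_of_nonneg_right ht1 (by linarith)
    nlinarith
  have h5 := le_of_mul_le_mul_left h4 (by linarith)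
  rcases min_le_iff.1 h5 with h | h <;> linarith

/-- The greedy count when the family at the end of the process is bounded exponentially in the
part of the sumset that is still unknown. -/
theorem card_filter_superset_le_two_mul {m : ℕ} {C T : Finset G} {lam n M : ℝ} (hlam : 0 < lam)
    (hn : 2 ≤ n) (hC : (C.card : ℝ) ≤ n) (hM : 0 < M) (S : Finset G) (hS : S.card ≤ m)
    (h : ∀ S' : Finset G, S ⊆ S' → S'.card ≤ m →
      ((sumsetFamily m S' (absorbed S' T C lam)).card : ℝ) ≤
        M * n ^ (2 * (m - S'.card : ℝ) / lam)) :
    (((sumsetFamily m S C).filter (T ⊆ ·)).card : ℝ) ≤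
      2 * (M * n ^ (2 * (m - S.card : ℝ) / lam)) := by
  have hn0 : 0 < n := by linarith
  -- Each greedy step lowers the exponent by at least 2: one factor n pays for the choice of a, the
  -- other for the 2 in `w`.
  refine card_filter_superset_le hlam.le
    (η := fun s => M * n ^ (2 * (m - s : ℝ) / lam))
    (w := fun s => 2 * (M * n ^ (2 * (m - s : ℝ) / lam))) ?_ ?_ S hS h
  · intro s _
    have : 0 < M * n ^ (2 * (m - s : ℝ) / lam) := by positivity
    linarith
  · intro s s' hs _
    have h1 : n ^ (2 * (m - s' : ℝ) / lam) ≤ n ^ (2 * (m - s : ℝ) / lam - 2) := by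
      refine Real.rpow_le_rpow_of_exponent_le (by linarith) ?_
      rw [le_sub_iff_add_le, div_add' _ _ _ hlam.ne']
      gcongr
      linarith
    have h2 : n ^ (2 * (m - s : ℝ) / lam - 2) * n ^ 2 = n ^ (2 * (m - s : ℝ) / lam) := by
      rw [← Real.rpow_natCast, ← Real.rpow_add hn0]; norm_num
    calc (C.card : ℝ) * (2 * (M * n ^ (2 * (m - s' : ℝ) / lam)))
        ≤ n * (n * (M * n ^ (2 * (m - s : ℝ) / lam - 2))) := by gcongr
      _ = M * (n ^ (2 * (m - s : ℝ) / lam - 2) * n ^ 2) := by ring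
      _ = 2 * (M * n ^ (2 * (m - s : ℝ) / lam)) - M * n ^ (2 * (m - s : ℝ) / lam) := by
        rw [h2]; ring

/-- The container recursion: `k` elements that each translate at least `κ` elements of `C` out of
`S` are absorbed, which enlarges `S` or shrinks `C`. -/
theorem card_sumsetFamily_le {m k : ℕ} {lam κ τ : ℝ} {Y : Finset G} (hY : 2 ≤ Y.card)
    (hk : 0 < k) (hlam : 0 < lam) (hκ : 0 < κ) (hkκ : 4 * (lam * m) ≤ k * κ)
    (hlow : ∀ S C : Finset G, S.card ≤ m → (C.card : ℝ) ≤ 2 * m →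
      ((C.filter fun c => ¬ κ ≤ ((escaping S C c).card : ℝ)).card : ℝ) ≤ τ)
    (S C : Finset G) (hS : S.card ≤ m) (hC : (C.card : ℝ) ≤ 2 * m) (hCY : C ⊆ Y) :
    ((sumsetFamily m S C).card : ℝ) ≤
      (Y.card : ℝ) ^ (2 * (m - S.card : ℝ) / lam + (k + 2) * (4 / κ) * (m - S.card + C.card) +
        (k + 1)) * 2 ^ τ := by
  induction hd : m - S.card + C.card using Nat.strong_induction_on generalizing S C with
  | _ d ih =>
  subst hd
  set n : ℝ := (Y.card : ℝ) with hn
  have hn2 : (2 : ℝ) ≤ n := by rw [hn]; exact_mod_cast hY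
  have hn0 : 0 < n := by linarith
  have hn1 : 1 ≤ n := by linarith
  have hSr : (S.card : ℝ) ≤ m := by exact_mod_cast hS
  have h2τ : (0 : ℝ) < 2 ^ τ := by positivity
  set D : Finset G := C.filter fun c => κ ≤ ((escaping S C c).card : ℝ) with hD
  have hDC : D ⊆ C := Finset.filter_subset _ _
  have hsd : C \ D = C.filter fun c => ¬ κ ≤ ((escaping S C c).card : ℝ) := by
    rw [hD, ← Finset.filter_not]
  set P : ℝ := 2 * (m - S.card : ℝ) / lam + (k + 2) * (4 / κ) * (m - S.card + C.card) with hP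
  have hP0 : 0 ≤ P := by
    have : (0 : ℝ) ≤ m - S.card := by linarith
    positivity
  have hfew : (((sumsetFamily m S C).filter fun A => (A ∩ D).card < k).card : ℝ) ≤
      n ^ (P + k) * 2 ^ τ := by
    have h1 := card_filter_inter_lt_le (sumsetFamily m S C) C D Y
      (fun A hA => (mem_sumsetFamily.1 hA).1) (hDC.trans hCY) hY k
    have h2 : (((sumsetFamily m S C).filter fun A => (A ∩ D).card < k).card : ℝ) ≤
        n ^ (k : ℝ) * 2 ^ (((C \ D).card : ℕ) : ℝ) := by
      rw [Real.rpow_natCast, Real.rpow_natCast, hn]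
      exact_mod_cast h1
    refine h2.trans (mul_le_mul ?_ ?_ (by positivity) (by positivity))
    · exact Real.rpow_le_rpow_of_exponent_le hn1 (by linarith)
    · refine Real.rpow_le_rpow_of_exponent_le one_le_two ?_
      rw [hsd]
      exact hlow S C hS hC
  have hmany : (((sumsetFamily m S C).filter fun A => k ≤ (A ∩ D).card).card : ℝ) ≤
      n ^ (P + k) * 2 ^ τ := by
    -- A round costs n^(k + 2): k for T, one for the factor 2 of the greedy count, one for the
    -- few/many split. The drop κ/4 pays for it. The greedy cost is charged to the growth of S and
    -- telescopes over all rounds.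
    set M : ℝ := n ^ ((k + 2) * (4 / κ) * (m - S.card + C.card) - 1) * 2 ^ τ with hM
    have hM0 : 0 < M := by positivity
    have hb : n ^ k * (2 * (M * n ^ (2 * (m - S.card : ℝ) / lam))) ≤ n ^ (P + k) * 2 ^ τ := by
      calc n ^ k * (2 * (M * n ^ (2 * (m - S.card : ℝ) / lam)))
          ≤ n ^ k * (n * (M * n ^ (2 * (m - S.card : ℝ) / lam))) := by gcongr
        _ = n ^ (k : ℝ) * n ^ (1 : ℝ) *
            n ^ ((k + 2) * (4 / κ) * (m - S.card + C.card) - 1) *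
            n ^ (2 * (m - S.card : ℝ) / lam) * 2 ^ τ := by
          rw [Real.rpow_natCast, Real.rpow_one, hM]; ring
        _ = n ^ (P + k) * 2 ^ τ := by
          rw [← Real.rpow_add hn0, ← Real.rpow_add hn0, ← Real.rpow_add hn0, hP]
          ring_nf
    refine le_trans (card_filter_le_inter_le _ D k Y.card (Finset.card_le_card (hDC.trans hCY))
      (b := 2 * (M * n ^ (2 * (m - S.card : ℝ) / lam))) (by positivity) ?_) hb
    intro T hT
    rw [Finset.mem_powersetCard] at hT
    refine card_filter_superset_le_two_mul hlam hn2
      (by rw [hn]; exact_mod_cast Finset.card_le_card hCY) hM0 S hS fun S' hSS' hS'm => ?_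
    have hsub := absorbed_subset S' T C lam
    have hdrop := card_absorbed_sub_le (T := T) (C := C) (lam := lam) (κ := κ) hSS'
      (by omega) (by rw [hT.2]; nlinarith) hκ.le
      (fun t ht => (Finset.mem_filter.1 (hT.1 ht)).2)
    have hcard : ((absorbed S' T C lam).card : ℝ) ≤ C.card := by
      exact_mod_cast Finset.card_le_card hsub
    have hlt : m - S'.card + (absorbed S' T C lam).card < m - S.card + C.card := by
      rw [← Nat.cast_lt (α := ℝ)]
      push_cast [Nat.cast_sub hS'm, Nat.cast_sub hS]
      linarith
    refine (ih _ hlt S' _ hS'm (hcard.trans hC) (hsub.trans hCY) rfl).trans ?_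
    have hexp : (k + 2) * (4 / κ) * (m - S'.card + (absorbed S' T C lam).card : ℝ) ≤
        (k + 2) * (4 / κ) * (m - S.card + C.card) - (k + 2) := by
      have h1 : (m - S'.card + (absorbed S' T C lam).card : ℝ) ≤ m - S.card + C.card - κ / 4 := by
        linarith
      calc _ ≤ (k + 2) * (4 / κ) * (m - S.card + C.card - κ / 4 : ℝ) := by gcongr
        _ = _ := by field_simp
    calc n ^ (2 * (m - S'.card : ℝ) / lam + (k + 2) * (4 / κ) *
            (m - S'.card + (absorbed S' T C lam).card) + (k + 1)) * 2 ^ τ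
        ≤ n ^ (((k + 2) * (4 / κ) * (m - S.card + C.card) - 1) +
            2 * (m - S'.card : ℝ) / lam) * 2 ^ τ := by
          refine mul_le_mul_of_nonneg_right ?_ h2τ.le
          exact Real.rpow_le_rpow_of_exponent_le hn1 (by linarith)
      _ = M * n ^ (2 * (m - S'.card : ℝ) / lam) := by
          rw [Real.rpow_add hn0, hM]; ring
  have hsplit : ((sumsetFamily m S C).card : ℝ) =
      ((sumsetFamily m S C).filter fun A => (A ∩ D).card < k).card +
        ((sumsetFamily m S C).filter fun A => k ≤ (A ∩ D).card).card := by
    have := Finset.card_filter_add_card_filter_not (s := sumsetFamily m S C)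
      (fun A => (A ∩ D).card < k)
    simp only [not_lt] at this
    exact_mod_cast this.symm
  calc ((sumsetFamily m S C).card : ℝ) ≤ 2 * (n ^ (P + k) * 2 ^ τ) := by rw [hsplit]; linarith
    _ ≤ n * (n ^ (P + k) * 2 ^ τ) := by gcongr
    _ = n ^ (P + (k + 1)) * 2 ^ τ := by
      rw [← add_assoc, Real.rpow_add_one hn0.ne']; ring

/-- The container recursion started from `k` elements of `A` and an empty part of the sumset. -/
theorem card_smallSumsetFamily_le {m k : ℕ} {lam κ τ : ℝ} {Y : Finset G} (hY : 2 ≤ Y.card)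
    (hk : 0 < k) (hlam : 0 < lam) (hκ : 0 < κ) (hkκ : 4 * (lam * m) ≤ k * κ)
    (hklam : 2 * lam ≤ k) (hτ : 0 ≤ τ)
    (hlow : ∀ S C : Finset G, S.card ≤ m → (C.card : ℝ) ≤ 2 * m →
      ((C.filter fun c => ¬ κ ≤ ((escaping S C c).card : ℝ)).card : ℝ) ≤ τ) :
    ((smallSumsetFamily Y m).card : ℝ) ≤
      (Y.card : ℝ) ^ (2 * m / lam + (k + 2) * (4 / κ) * (3 * m) + (2 * k + 3)) * 2 ^ τ := by
  set n : ℝ := (Y.card : ℝ) with hn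
  have hn2 : (2 : ℝ) ≤ n := by rw [hn]; exact_mod_cast hY
  have hn0 : 0 < n := by linarith
  have hn1 : 1 ≤ n := by linarith
  have h2τ : (1 : ℝ) ≤ 2 ^ τ := Real.one_le_rpow one_le_two hτ
  have hfam : smallSumsetFamily Y m = sumsetFamily m ∅ Y := by
    simp [smallSumsetFamily, sumsetFamily]
  rw [hfam]
  set Q : ℝ := 2 * m / lam + (k + 2) * (4 / κ) * (3 * m) with hQ
  have hQ0 : 0 ≤ Q := by positivity
  have hfew : (((sumsetFamily m ∅ Y).filter fun A => (A ∩ Y).card < k).card : ℝ) ≤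
      n ^ (Q + (2 * k + 2)) * 2 ^ τ := by
    have h1 := card_filter_inter_lt_le (sumsetFamily m ∅ Y) Y Y Y
      (fun A hA => (mem_sumsetFamily.1 hA).1) subset_rfl hY k
    rw [sdiff_self, Finset.bot_eq_empty, Finset.card_empty, pow_zero, mul_one] at h1
    have h2 : (((sumsetFamily m ∅ Y).filter fun A => (A ∩ Y).card < k).card : ℝ) ≤
        n ^ (k : ℝ) := by
      rw [Real.rpow_natCast, hn]
      exact_mod_cast h1
    calc _ ≤ n ^ (k : ℝ) := h2
      _ ≤ n ^ (Q + (2 * k + 2)) :=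
        Real.rpow_le_rpow_of_exponent_le hn1 (by linarith [Nat.cast_nonneg (α := ℝ) k])
      _ ≤ _ := le_mul_of_one_le_right (by positivity) h2τ
  have hmany : (((sumsetFamily m ∅ Y).filter fun A => k ≤ (A ∩ Y).card).card : ℝ) ≤
      n ^ (Q + (2 * k + 2)) * 2 ^ τ := by
    set M : ℝ := n ^ ((k + 2) * (4 / κ) * (3 * m) + (k + 1)) * 2 ^ τ with hM
    have hM0 : 0 < M := by positivity
    have hb : n ^ k * (2 * (M * n ^ (2 * (m - (∅ : Finset G).card : ℝ) / lam))) ≤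
        n ^ (Q + (2 * k + 2)) * 2 ^ τ := by
      rw [Finset.card_empty, Nat.cast_zero, sub_zero]
      calc n ^ k * (2 * (M * n ^ (2 * m / lam))) ≤ n ^ k * (n * (M * n ^ (2 * m / lam))) := by
            gcongr
        _ = n ^ (k : ℝ) * n ^ (1 : ℝ) * n ^ ((k + 2) * (4 / κ) * (3 * m) + (k + 1)) *
            n ^ (2 * m / lam) * 2 ^ τ := by
          rw [Real.rpow_natCast, Real.rpow_one, hM]; ring
        _ = _ := by
          rw [← Real.rpow_add hn0, ← Real.rpow_add hn0, ← Real.rpow_add hn0, hQ]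
          ring_nf
    refine le_trans (card_filter_le_inter_le _ Y k Y.card le_rfl
      (b := 2 * (M * n ^ (2 * (m - (∅ : Finset G).card : ℝ) / lam))) (by positivity) ?_) hb
    intro T hT
    rw [Finset.mem_powersetCard] at hT
    refine card_filter_superset_le_two_mul hlam hn2 hn.ge hM0 ∅ (by simp) fun S' _ hS'm => ?_
    have hkr : (0 : ℝ) < k := by exact_mod_cast hk
    have hSr : (S'.card : ℝ) ≤ m := by exact_mod_cast hS'm
    -- As `lam` ≤ k/2, absorption by k elements brings C from n down to 2m elements, and the
    -- potential m - |S| + |C| to at most 3m.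
    have habs : ((absorbed S' T Y lam).card : ℝ) ≤ 2 * m := by
      have h1 := card_absorbed_mul_le S' T Y lam
      rw [hT.2] at h1
      have h2 : (k : ℝ) * ((absorbed S' T Y lam).card / 2) ≤ k * S'.card := by
        nlinarith [Nat.cast_nonneg (α := ℝ) (absorbed S' T Y lam).card]
      have h3 := le_of_mul_le_mul_left h2 hkr
      linarith
    refine (card_sumsetFamily_le hY hk hlam hκ hkκ hlow S' _ hS'm habs
      (absorbed_subset _ _ _ _)).trans ?_
    have hexp : (k + 2) * (4 / κ) * (m - S'.card + (absorbed S' T Y lam).card : ℝ) ≤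
        (k + 2) * (4 / κ) * (3 * m) := by
      gcongr
      linarith [Nat.cast_nonneg (α := ℝ) S'.card]
    calc _ ≤ n ^ (((k + 2) * (4 / κ) * (3 * m) + (k + 1)) + 2 * (m - S'.card : ℝ) / lam) *
            2 ^ τ := by
          refine mul_le_mul_of_nonneg_right ?_ (by positivity)
          exact Real.rpow_le_rpow_of_exponent_le hn1 (by linarith)
      _ = M * n ^ (2 * (m - S'.card : ℝ) / lam) := by
          rw [Real.rpow_add hn0, hM]; ring
  have hsplit : ((sumsetFamily m ∅ Y).card : ℝ) =
      ((sumsetFamily m ∅ Y).filter fun A => (A ∩ Y).card < k).card +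
        ((sumsetFamily m ∅ Y).filter fun A => k ≤ (A ∩ Y).card).card := by
    have := Finset.card_filter_add_card_filter_not (s := sumsetFamily m ∅ Y)
      (fun A => (A ∩ Y).card < k)
    simp only [not_lt] at this
    exact_mod_cast this.symm
  calc ((sumsetFamily m ∅ Y).card : ℝ) ≤ 2 * (n ^ (Q + (2 * k + 2)) * 2 ^ τ) := by
        rw [hsplit]; linarith
    _ ≤ n * (n ^ (Q + (2 * k + 2)) * 2 ^ τ) := by gcongr
    _ = n ^ (Q + (2 * k + 3)) * 2 ^ τ := by
      rw [show Q + (2 * k + 3 : ℝ) = Q + (2 * k + 2) + 1 by ring, Real.rpow_add_one hn0.ne']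
      ring

end LargeSumset

/-! ### Elementary facts on β, log n and α -/

theorem natCard_le_subgroupBeta {G : Type u} [AddCommGroup G] {x : ℝ} (H : AddSubgroup G) (hfin : Finite H)
    (h : (Nat.card H : ℝ) ≤ x) : Nat.card H ≤ subgroupBeta G x := by
  refine le_csSup ⟨⌊x⌋₊, ?_⟩ ⟨h, H, hfin, rfl⟩
  rintro k ⟨hk, -⟩
  exact Nat.le_floor hk

theorem one_le_subgroupBeta {G : Type u} [AddCommGroup G] {x : ℝ} (hx : 1 ≤ x) : 1 ≤ subgroupBeta G x := by
  have h := natCard_le_subgroupBeta (x := x) (⊥ : AddSubgroup G) inferInstance (by simpa using hx)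
  simpa using h

theorem logb_two_natCast_nonneg (n : ℕ) : 0 ≤ Real.logb 2 (n : ℝ) :=
  div_nonneg (Real.log_natCast_nonneg n) (Real.log_nonneg one_le_two)

theorem natCast_rpow_eq_two_rpow {n : ℕ} (hn : 0 < n) (x : ℝ) :
    (n : ℝ) ^ x = 2 ^ (Real.logb 2 n * x) := by
  rw [Real.rpow_mul zero_le_two, Real.rpow_logb zero_lt_two (by norm_num) (by exact_mod_cast hn)]

theorem one_le_logb_two_natCast {n : ℕ} (hn : 2 ≤ n) : 1 ≤ Real.logb 2 n := by
  rw [Real.le_logb_iff_rpow_le one_lt_two (by positivity), Real.rpow_one]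
  exact_mod_cast hn

theorem sumsetAlpha_nonneg (n m : ℕ) : 0 ≤ sumsetAlpha n m :=
  Real.rpow_nonneg (div_nonneg (Real.sqrt_nonneg _) (logb_two_natCast_nonneg n)) _

theorem sumsetAlpha_sq (n m : ℕ) : sumsetAlpha n m ^ 2 = √(m : ℝ) / Real.logb 2 n := by
  have h0 : 0 ≤ √(m : ℝ) / Real.logb 2 n :=
    div_nonneg (Real.sqrt_nonneg _) (logb_two_natCast_nonneg n)
  rw [sumsetAlpha, ← Real.rpow_natCast, ← Real.rpow_mul h0]
  norm_num

theorem sumsetAlpha_rpow_cube (n m : ℕ) :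
    (sumsetAlpha n m ^ (-2 / 3 : ℝ)) ^ 3 = Real.logb 2 n / √(m : ℝ) := by
  rw [← Real.rpow_natCast, ← Real.rpow_mul (sumsetAlpha_nonneg n m)]
  rw [show (-2 / 3 : ℝ) * (3 : ℕ) = -(2 : ℕ) by norm_num, Real.rpow_neg (sumsetAlpha_nonneg n m),
    Real.rpow_natCast, sumsetAlpha_sq, inv_div]

/-! ### The two explicit bounds -/

section Bounds

variable {G : Type u} [AddCommGroup G] [DecidableEq G]

theorem card_smallSumsetFamily_le_of_le_sq {n m : ℕ} (hn : 1 ≤ n) (hm : 1 ≤ m) {Y : Finset G}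
    (hY : Y.card = n) (h : (m : ℝ) ≤ Real.logb 2 n ^ 2) :
    ((smallSumsetFamily Y m).card : ℝ) ≤
      (2 : ℝ) ^ ((2 + 3 * sumsetAlpha n m) * √(m : ℝ) * Real.logb 2 n + m) := by
  have hm1 : (1 : ℝ) ≤ m := by exact_mod_cast hm
  have hn2 : 2 ≤ n := by
    by_contra hlt
    obtain rfl : n = 1 := by omega
    norm_num at h
    linarith
  have hn2r : (2 : ℝ) ≤ n := by exact_mod_cast hn2
  have hn0 : (0 : ℝ) < n := by linarith
  have hn1 : (1 : ℝ) ≤ n := by linarith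
  have hL1 := one_le_logb_two_natCast hn2
  have hα2 := sumsetAlpha_sq n m
  have hα0 := sumsetAlpha_nonneg n m
  set α := sumsetAlpha n m with hα
  set L := Real.logb 2 (n : ℝ) with hL
  set r := √(m : ℝ) with hr
  have hr2 : r ^ 2 = m := Real.sq_sqrt (by linarith)
  have hr1 : 1 ≤ r := Real.one_le_sqrt.2 hm1
  have hr0 : 0 < r := by linarith
  have hrL : r ≤ L := by
    rw [← hr2] at h
    exact le_of_sq_le_sq h (by linarith)
  have hαL : α ^ 2 * L = r := by rw [hα2]; field_simp
  have hαpos : 0 < α := by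
    rcases hα0.eq_or_lt with h0 | h0
    · rw [← h0] at hαL; norm_num at hαL; linarith
    · exact h0
  have hα1 : α ≤ 1 := by
    have : α ^ 2 ≤ 1 := by rw [hα2]; exact (div_le_one (by linarith)).2 hrL
    nlinarith
  have hslack : (m : ℝ) / α = α * r * L := by
    rw [div_eq_iff hαpos.ne', ← hr2]
    nlinarith
  set k := ⌈(1 + α) * r⌉₊ with hk
  have hk1 : (1 + α) * r ≤ k := Nat.le_ceil _
  have hk2 : (k : ℝ) < (1 + α) * r + 1 := Nat.ceil_lt_add_one (by positivity)
  have hkr : 0 < k - r := by nlinarith [mul_pos hαpos hr0]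
  set M : ℝ := 2 ^ (m / α + m : ℝ) with hM
  have hM1 : 1 ≤ M := Real.one_le_rpow one_le_two (by positivity)
  have hfam : smallSumsetFamily Y m = sumsetFamily m ∅ Y := by
    simp [smallSumsetFamily, sumsetFamily]
  have hfew : (((sumsetFamily m ∅ Y).filter fun A => (A ∩ Y).card < k).card : ℝ) ≤ (n : ℝ) ^ k := by
    have h1 := card_filter_inter_lt_le (sumsetFamily m ∅ Y) Y Y Y
      (fun A hA => (mem_sumsetFamily.1 hA).1) subset_rfl (hY ▸ hn2) k
    rw [sdiff_self, Finset.bot_eq_empty, Finset.card_empty, pow_zero, mul_one, hY] at h1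
    exact_mod_cast h1
  -- The weight M(2n^((m - s)/r) - 1) solves the greedy recursion because n ≥ 2. It is taken at s =
  -- k since |T + T| ≥ k, and this head start offsets the rounding in k. The -1 pays for the sets
  -- with fewer than k elements.
  set b : ℝ := M * (2 * (n : ℝ) ^ ((m - k : ℝ) / r) - 1) with hb
  have hstep : ∀ s s' : ℕ, (s : ℝ) + r < s' → s' ≤ m →
      (Y.card : ℝ) * (M * (2 * (n : ℝ) ^ ((m - s' : ℝ) / r) - 1)) ≤
        M * (2 * (n : ℝ) ^ ((m - s : ℝ) / r) - 1) - M := by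
    intro s s' hs _
    rw [hY]
    have h1 : (n : ℝ) ^ ((m - s' : ℝ) / r) ≤ (n : ℝ) ^ ((m - s : ℝ) / r - 1) := by
      refine Real.rpow_le_rpow_of_exponent_le hn1 ?_
      rw [le_sub_iff_add_le, div_add' _ _ _ hr0.ne']
      gcongr
      linarith
    have h2 : (n : ℝ) ^ ((m - s : ℝ) / r - 1) * n = (n : ℝ) ^ ((m - s : ℝ) / r) := by
      rw [← Real.rpow_add_one hn0.ne']; norm_num
    have h3 : (n : ℝ) * (n : ℝ) ^ ((m - s' : ℝ) / r) ≤ (n : ℝ) ^ ((m - s : ℝ) / r) := by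
      rw [← h2, mul_comm]; gcongr
    have h4 : M * ((n : ℝ) * (2 * (n : ℝ) ^ ((m - s' : ℝ) / r) - 1)) ≤
        M * (2 * (n : ℝ) ^ ((m - s : ℝ) / r) - 1 - 1) :=
      mul_le_mul_of_nonneg_left (by linarith) (by linarith)
    linarith
  have hone : ∀ s : ℕ, s ≤ m → 1 ≤ (n : ℝ) ^ ((m - s : ℝ) / r) := by
    intro s hs
    have : (s : ℝ) ≤ m := by exact_mod_cast hs
    exact Real.one_le_rpow hn1 (div_nonneg (by linarith) hr0.le)
  have hmany : ∀ T ∈ Y.powersetCard k,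
      (((sumsetFamily m ∅ Y).filter (T ⊆ ·)).card : ℝ) ≤ max 0 b := by
    intro T hT
    rw [Finset.mem_powersetCard] at hT
    have hle : (((sumsetFamily m ∅ Y).filter (T ⊆ ·)).card : ℝ) ≤
        ((sumsetFamily m (T + T) Y).filter (T ⊆ ·)).card := by
      refine Nat.cast_le.2 (Finset.card_le_card fun A hA => ?_)
      rw [Finset.mem_filter, mem_sumsetFamily] at hA ⊢
      exact ⟨⟨hA.1.1, hA.1.2.1, Finset.add_subset_add hA.2 hA.2⟩, hA.2⟩
    refine hle.trans ?_
    by_cases hTT : (T + T).card ≤ m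
    · have hTne : T.Nonempty := Finset.card_pos.1 (by
        rw [hT.2]
        have : (0 : ℝ) < k := by linarith
        exact_mod_cast this)
      have hkT : k ≤ (T + T).card := hT.2 ▸ Finset.card_le_card_add_left hTne
      refine (card_filter_superset_le (lam := r) hr0.le (η := fun _ => M)
        (w := fun s => M * (2 * (n : ℝ) ^ ((m - s : ℝ) / r) - 1)) ?_ hstep (T + T) hTT ?_).trans ?_
      · intro s hs
        have := hone s hs
        exact le_mul_of_one_le_right (by linarith) (by linarith)
      · intro S' _ hS'
        have hS'r : (S'.card : ℝ) ≤ m := by exact_mod_cast hS'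
        have h1 := card_absorbed_mul_le S' T Y r
        rw [hT.2] at h1
        have h2 : ((absorbed S' T Y r).card : ℝ) ≤ m / α + m := by
          have h3 : (k : ℝ) * S'.card ≤ (k - r) * (m / α + m) := by
            have h4 : (k : ℝ) * S'.card ≤ k * m :=
              mul_le_mul_of_nonneg_left hS'r (Nat.cast_nonneg k)
            have h5 : (m : ℝ) / α + m = (1 + α) * (m / α) := by field_simp
            have h6 : (k : ℝ) * m = (k * α) * (m / α) := by field_simp
            have h7 : k * α ≤ (k - r) * (1 + α) := by linarith
            have h8 : 0 ≤ (m : ℝ) / α := by positivity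
            have h9 := mul_le_mul_of_nonneg_right h7 h8
            rw [h5]
            linarith
          exact le_of_mul_le_mul_left (h1.trans h3) hkr
        calc ((sumsetFamily m S' (absorbed S' T Y r)).card : ℝ)
            ≤ (2 : ℝ) ^ ((absorbed S' T Y r).card : ℝ) := by
              rw [Real.rpow_natCast]
              exact_mod_cast sumsetFamily_card_le_two_pow m S' _
          _ ≤ M := Real.rpow_le_rpow_of_exponent_le one_le_two h2
      · refine le_max_of_le_right ?_
        have hkT' : (k : ℝ) ≤ (T + T).card := by exact_mod_cast hkT
        refine mul_le_mul_of_nonneg_left ?_ (by linarith)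
        have : (n : ℝ) ^ ((m - (T + T).card : ℝ) / r) ≤ (n : ℝ) ^ ((m - k : ℝ) / r) :=
          Real.rpow_le_rpow_of_exponent_le hn1 (by gcongr)
        linarith
    · have : (sumsetFamily m (T + T) Y).filter (T ⊆ ·) = ∅ := by
        refine Finset.eq_empty_of_forall_notMem fun A hA => hTT ?_
        rw [Finset.mem_filter, mem_sumsetFamily] at hA
        exact (Finset.card_le_card hA.1.2.2).trans hA.1.2.1
      rw [this]
      simp
  have hmany' := card_filter_le_inter_le (sumsetFamily m ∅ Y) Y k n hY.le (le_max_left 0 b) hmany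
  have hsplit : ((sumsetFamily m ∅ Y).card : ℝ) =
      ((sumsetFamily m ∅ Y).filter fun A => (A ∩ Y).card < k).card +
        ((sumsetFamily m ∅ Y).filter fun A => k ≤ (A ∩ Y).card).card := by
    have := Finset.card_filter_add_card_filter_not (s := sumsetFamily m ∅ Y)
      (fun A => (A ∩ Y).card < k)
    simp only [not_lt] at this
    exact_mod_cast this.symm
  have hkexp : (k : ℝ) + (m - k) / r ≤ (2 + α) * r := by
    have h1 : (m : ℝ) / r = r := by rw [← hr2]; field_simp
    have h2 : (1 + α) ≤ k / r := by rw [le_div_iff₀ hr0]; exact hk1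
    rw [sub_div, h1]
    linarith
  have hkexp' : (k : ℝ) ≤ (2 + α) * r := by linarith
  have hnk : (n : ℝ) ^ k ≤ (n : ℝ) ^ ((2 + α) * r) := by
    rw [← Real.rpow_natCast]; exact Real.rpow_le_rpow_of_exponent_le hn1 hkexp'
  have hnkb : (n : ℝ) ^ k * (n : ℝ) ^ ((m - k : ℝ) / r) ≤ (n : ℝ) ^ ((2 + α) * r) := by
    rw [← Real.rpow_natCast, ← Real.rpow_add hn0]
    exact Real.rpow_le_rpow_of_exponent_le hn1 hkexp
  have htotal : ((smallSumsetFamily Y m).card : ℝ) ≤ (n : ℝ) ^ ((2 + α) * r) * (2 * M) := by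
    have hpos : (0 : ℝ) < (n : ℝ) ^ ((2 + α) * r) := by positivity
    have hkpos : (0 : ℝ) < (n : ℝ) ^ k := by positivity
    rw [hfam, hsplit]
    rcases le_total 0 b with hb0 | hb0
    · rw [max_eq_right hb0] at hmany'
      have h1 : (n : ℝ) ^ k * b = 2 * M * ((n : ℝ) ^ k * (n : ℝ) ^ ((m - k : ℝ) / r)) -
        M * (n : ℝ) ^ k := by rw [hb]; ring
      have h2 : 2 * M * ((n : ℝ) ^ k * (n : ℝ) ^ ((m - k : ℝ) / r)) ≤
        2 * M * (n : ℝ) ^ ((2 + α) * r) := by gcongr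
      nlinarith
    · rw [max_eq_left hb0] at hmany'
      nlinarith
  refine htotal.trans ?_
  rw [natCast_rpow_eq_two_rpow (by omega)]
  calc (2 : ℝ) ^ (L * ((2 + α) * r)) * (2 * M)
      = 2 ^ (L * ((2 + α) * r) + (1 + (m / α + m))) := by
        rw [Real.rpow_add two_pos, Real.rpow_add two_pos, Real.rpow_one, hM]
    _ ≤ _ := by
        refine Real.rpow_le_rpow_of_exponent_le one_le_two ?_
        -- Since m/α = αrL, the three α's come from k, from the container, and from the factor 2,
        -- which is at most 2^(m/α).
        have h1 : 1 ≤ (m : ℝ) / α := by rw [le_div_iff₀ hαpos]; linarith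
        linarith

theorem card_smallSumsetFamily_le_of_sq_lt {n m : ℕ} (hn : 1 ≤ n) (hm : 1 ≤ m) {Y : Finset G}
    (hY : Y.card = n) (h : Real.logb 2 n ^ 2 < (m : ℝ)) :
    ((smallSumsetFamily Y m).card : ℝ) ≤
      (2 : ℝ) ^ (((m : ℝ) + subgroupBeta G (m + sumsetAlpha n m ^ (-2 / 3 : ℝ) * m)) / 2
        + 2 ^ 13 * sumsetAlpha n m ^ (-2 / 3 : ℝ) * m) := by
  have hm1 : (1 : ℝ) ≤ m := by exact_mod_cast hm
  have hε0 : 0 ≤ sumsetAlpha n m ^ (-2 / 3 : ℝ) := Real.rpow_nonneg (sumsetAlpha_nonneg n m) _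
  have hε3 := sumsetAlpha_rpow_cube n m
  set ε := sumsetAlpha n m ^ (-2 / 3 : ℝ) with hε
  have hx1 : 1 ≤ (m : ℝ) + ε * m := by nlinarith
  -- For n = 1 there are at most two sets, and m, β ≥ 1 already give exponent 1.
  rcases hn.eq_or_lt with rfl | hn2
  · have hβ : (1 : ℝ) ≤ subgroupBeta G (m + ε * m) := by exact_mod_cast one_le_subgroupBeta hx1
    have h1 : (smallSumsetFamily Y m).card ≤ 2 ^ 1 := by
      rw [← hY, ← Finset.card_powerset]; exact Finset.card_filter_le _ _
    calc ((smallSumsetFamily Y m).card : ℝ) ≤ (2 : ℝ) ^ (1 : ℝ) := by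
          rw [Real.rpow_one]; exact_mod_cast h1
      _ ≤ _ := by
        refine Real.rpow_le_rpow_of_exponent_le one_le_two ?_
        have : 0 ≤ 2 ^ 13 * ε * m := by positivity
        linarith
  obtain ⟨β, hβ⟩ : ∃ β : ℝ, β = (subgroupBeta G (m + ε * m) : ℕ) := ⟨_, rfl⟩
  rw [← hβ]
  have hβ0 : 0 ≤ β := hβ ▸ Nat.cast_nonneg _
  have hL1 := one_le_logb_two_natCast hn2
  set L := Real.logb 2 (n : ℝ) with hL
  set r := √(m : ℝ) with hr
  have hr2 : r ^ 2 = m := Real.sq_sqrt (by linarith)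
  have hr1 : 1 ≤ r := Real.one_le_sqrt.2 hm1
  have hr0 : 0 < r := by linarith
  have hLr : L < r := by
    rw [← hr2] at h
    exact lt_of_pow_lt_pow_left₀ 2 hr0.le h
  have hεL : ε ^ 3 * r = L := by rw [hε3]; field_simp
  have hεpos : 0 < ε := by
    rcases hε0.eq_or_lt with h0 | h0
    · rw [← h0] at hεL; norm_num at hεL; linarith
    · exact h0
  have hε1 : ε < 1 := by
    have : ε ^ 3 < 1 := by rw [hε3]; exact (div_lt_one hr0).2 hLr
    exact lt_of_pow_lt_pow_left₀ 3 zero_le_one (by simpa using this)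
  have hεm : 1 ≤ ε * m := by
    have h1 : ε ^ 3 ≤ ε := by
      have : ε ^ 2 ≤ 1 := pow_le_one₀ hε0 hε1.le
      nlinarith
    calc 1 ≤ L := hL1
      _ = ε ^ 3 * r := hεL.symm
      _ ≤ ε * m := by
        rw [← hr2]
        exact mul_le_mul h1 (by nlinarith) hr0.le hε0
  set k := ⌈r⌉₊ with hk
  have hk1 : r ≤ k := Nat.le_ceil _
  have hk2 : (k : ℝ) < r + 1 := Nat.ceil_lt_add_one hr0.le
  have hkpos : 0 < k := Nat.ceil_pos.2 hr0
  have hε2 : ε ^ 2 ≤ 1 := pow_le_one₀ hε0 hε1.le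
  have hε2pos : 0 < ε ^ 2 := by positivity
  -- `κ` is dictated by the Pollard step, and `lam` then makes 4 · `lam` · m equal to r · `κ`.
  have hmain := card_smallSumsetFamily_le (m := m) (k := k) (lam := ε ^ 2 * r / 16)
    (κ := ε ^ 2 / 4 * m) (τ := (m + β) / 2 + 2 * ε * m) (Y := Y) (hY ▸ hn2) hkpos
    (by positivity) (by positivity)
    (by
      have : r * (ε ^ 2 / 4 * m) ≤ k * (ε ^ 2 / 4 * m) :=
        mul_le_mul_of_nonneg_right hk1 (by positivity)
      linarith)
    (by nlinarith) (by positivity)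
    (fun S C hS hC => card_le_of_card_escaping_le hεpos hεm hβ0
      (fun H hfin hH => by rw [hβ]; exact_mod_cast natCard_le_subgroupBeta H hfin hH)
      (Finset.filter_subset _ _) hS hC
      (fun c hc => (not_le.1 (Finset.mem_filter.1 hc).2).le))
  refine hmain.trans ?_
  rw [hY, natCast_rpow_eq_two_rpow (by omega), ← Real.rpow_add two_pos]
  refine Real.rpow_le_rpow_of_exponent_le one_le_two ?_
  -- 231 = 32 + 48 · 4 + 7. As L = ε³r, the choices cost 231εm; with the 2εm from `τ` this is far
  -- below 2^13 εm.
  have hexp : 2 * m / (ε ^ 2 * r / 16) + (k + 2) * (4 / (ε ^ 2 / 4 * m)) * (3 * m) + (2 * k + 3) ≤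
      231 * (r / ε ^ 2) := by
    have h1 : 2 * m / (ε ^ 2 * r / 16) = 32 * (r / ε ^ 2) := by
      rw [← hr2]; field_simp; norm_num
    have h2 : (k + 2) * (4 / (ε ^ 2 / 4 * m)) * (3 * m) = 48 * ((k + 2) / ε ^ 2) := by
      field_simp; norm_num
    have h3 : (k + 2) / ε ^ 2 ≤ 4 * (r / ε ^ 2) := by
      rw [← mul_div_assoc]; gcongr; linarith
    have h4 : r ≤ r / ε ^ 2 := le_div_self hr0.le hε2pos hε2
    rw [h1, h2]
    linarith
  have h1 : L * (231 * (r / ε ^ 2)) = 231 * (ε * m) := by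
    rw [← hεL, ← hr2]; field_simp
  have h2 := mul_le_mul_of_nonneg_left hexp (show 0 ≤ L by linarith)
  rw [h1] at h2
  linarith

end Bounds

/-! ### Asymptotic forms -/

theorem tendsto_sumsetAlpha_zero {m : ℕ → ℕ}
    (h : (fun n : ℕ => (m n : ℝ)) =o[Filter.atTop] (fun n : ℕ => Real.logb 2 (n : ℝ) ^ 2)) :
    Filter.Tendsto (fun n => √(m n : ℝ) / Real.logb 2 n) Filter.atTop (nhds 0) ∧
      Filter.Tendsto (fun n => sumsetAlpha n (m n)) Filter.atTop (nhds 0) := by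
  have h1 : Filter.Tendsto (fun n => √(m n : ℝ) / Real.logb 2 n) Filter.atTop (nhds 0) := by
    have h2 := (Real.continuous_sqrt.tendsto 0).comp h.tendsto_div_nhds_zero
    rw [Real.sqrt_zero] at h2
    refine h2.congr fun n => ?_
    simp only [Function.comp]
    rw [Real.sqrt_div (Nat.cast_nonneg _),
      Real.sqrt_sq (logb_two_natCast_nonneg n)]
  refine ⟨h1, ?_⟩
  have h2 := h1.rpow_const (p := 1 / 2) (Or.inr (by norm_num))
  rwa [Real.zero_rpow (by norm_num)] at h2

theorem tendsto_sumsetAlpha_rpow_zero {m : ℕ → ℕ}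
    (h : (fun n : ℕ => Real.logb 2 (n : ℝ) ^ 2) =o[Filter.atTop] (fun n : ℕ => (m n : ℝ))) :
    Filter.Tendsto (fun n => sumsetAlpha n (m n) ^ (-2 / 3 : ℝ)) Filter.atTop (nhds 0) := by
  have h1 := h.tendsto_div_nhds_zero.rpow_const (p := 1 / 6) (Or.inr (by norm_num))
  rw [Real.zero_rpow (by norm_num)] at h1
  refine h1.congr fun n => ?_
  have h0 := logb_two_natCast_nonneg n
  have hε0 : 0 ≤ sumsetAlpha n (m n) ^ (-2 / 3 : ℝ) := Real.rpow_nonneg (sumsetAlpha_nonneg _ _) _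
  have h2 : Real.logb 2 (n : ℝ) ^ 2 / (m n : ℝ) =
      (sumsetAlpha n (m n) ^ (-2 / 3 : ℝ)) ^ (6 : ℕ) := by
    rw [show (6 : ℕ) = 3 * 2 by norm_num, pow_mul, sumsetAlpha_rpow_cube, div_pow,
      Real.sq_sqrt (Nat.cast_nonneg _)]
  rw [h2, ← Real.rpow_natCast, ← Real.rpow_mul hε0]
  norm_num

theorem theorem1p4 :
    -- the explicit bounds, for all `n, m ≥ 1`
    (∀ (n m : ℕ), 1 ≤ n → 1 ≤ m →
      ∀ (G : Type u) [AddCommGroup G] [DecidableEq G] (Y : Finset G), Y.card = n →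
        ((m : ℝ) ≤ Real.logb 2 n ^ 2 →
          ((smallSumsetFamily Y m).card : ℝ) ≤
            (2 : ℝ) ^ ((2 + 3 * sumsetAlpha n m) * √(m : ℝ) * Real.logb 2 n + m)) ∧
        (Real.logb 2 n ^ 2 < (m : ℝ) →
          ((smallSumsetFamily Y m).card : ℝ) ≤
            (2 : ℝ) ^ (((m : ℝ)
                + subgroupBeta G (m + sumsetAlpha n m ^ (-2 / 3 : ℝ) * m)) / 2
              + 2 ^ 13 * sumsetAlpha n m ^ (-2 / 3 : ℝ) * m))) ∧
    -- the case `m ≪ (log n)²`; the `o(1)` term depends only on the function `m`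
    (∀ m : ℕ → ℕ, (∀ n, 1 ≤ m n) →
      (fun n : ℕ => (m n : ℝ)) =o[Filter.atTop] (fun n : ℕ => Real.logb 2 (n : ℝ) ^ 2) →
      ∃ f : ℕ → ℝ, Filter.Tendsto f Filter.atTop (nhds 0) ∧
        ∀ᶠ n : ℕ in Filter.atTop,
          ∀ (G : Type u) [AddCommGroup G] [DecidableEq G] (Y : Finset G), Y.card = n →
            ((smallSumsetFamily Y (m n)).card : ℝ) ≤ (n : ℝ) ^ ((2 + f n) * √(m n : ℝ))) ∧
    -- the case `m ≫ (log n)²`; the `o(m)` term depends only on the function `m`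
    (∀ m : ℕ → ℕ, (∀ n, 1 ≤ m n) →
      (fun n : ℕ => Real.logb 2 (n : ℝ) ^ 2) =o[Filter.atTop] (fun n : ℕ => (m n : ℝ)) →
      ∃ g : ℕ → ℝ, g =o[Filter.atTop] (fun n : ℕ => (m n : ℝ)) ∧
        ∀ᶠ n : ℕ in Filter.atTop,
          ∀ (G : Type u) [AddCommGroup G] [DecidableEq G] (Y : Finset G), Y.card = n →
            ((smallSumsetFamily Y (m n)).card : ℝ) ≤
              (2 : ℝ) ^ (((m n : ℝ) + subgroupBeta G
                  (m n + sumsetAlpha n (m n) ^ (-2 / 3 : ℝ) * m n)) / 2 + g n)) := by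
  refine ⟨fun n m hn hm G _ _ Y hY => ⟨card_smallSumsetFamily_le_of_le_sq hn hm hY,
    card_smallSumsetFamily_le_of_sq_lt hn hm hY⟩, fun m hm h => ?_, fun m hm h => ?_⟩
  · obtain ⟨h1, h2⟩ := tendsto_sumsetAlpha_zero h
    -- The second summand absorbs 2^m, as log n · (√m / log n) · √m = m.
    refine ⟨fun n => 3 * sumsetAlpha n (m n) + √(m n : ℝ) / Real.logb 2 n, ?_, ?_⟩
    · simpa using (h2.const_mul 3).add h1
    · filter_upwards [h.bound one_pos, Filter.eventually_ge_atTop 2] with n hb hn G _ _ Y hY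
      have hL := one_le_logb_two_natCast hn
      rw [one_mul, Real.norm_of_nonneg (Nat.cast_nonneg _), Real.norm_of_nonneg (sq_nonneg _)] at hb
      refine (card_smallSumsetFamily_le_of_le_sq (by omega) (hm n) hY hb).trans_eq ?_
      rw [natCast_rpow_eq_two_rpow (by omega)]
      congr 1
      have h3 : (m n : ℝ) = √(m n : ℝ) * √(m n : ℝ) := (Real.mul_self_sqrt (Nat.cast_nonneg _)).symm
      have h4 : Real.logb 2 (n : ℝ) * (√(m n : ℝ) / Real.logb 2 n * √(m n : ℝ)) = m n := by
        rw [← mul_assoc, mul_div_cancel₀ _ (by linarith), ← h3]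
      linear_combination -h4
  · have h1 := tendsto_sumsetAlpha_rpow_zero h
    refine ⟨fun n => 2 ^ 13 * sumsetAlpha n (m n) ^ (-2 / 3 : ℝ) * m n, ?_, ?_⟩
    · refine (Asymptotics.isLittleO_iff_tendsto' ?_).2 ?_
      · filter_upwards with n h0
        have := hm n
        have h3 : m n = 0 := by exact_mod_cast h0
        omega
      · have h2 := h1.const_mul (2 ^ 13)
        rw [mul_zero] at h2
        refine h2.congr fun n => ?_
        have : (m n : ℝ) ≠ 0 := by
          have := hm n
          positivity
        field_simp
    -- The constant 1/2, with m ≥ 1, yields the strict inequality required.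
    · filter_upwards [h.bound (show (0 : ℝ) < 1 / 2 by norm_num), Filter.eventually_ge_atTop 2]
        with n hb hn G _ _ Y hY
      have hm1 : (1 : ℝ) ≤ m n := by exact_mod_cast hm n
      rw [Real.norm_of_nonneg (Nat.cast_nonneg _), Real.norm_of_nonneg (sq_nonneg _)] at hb
      exact card_smallSumsetFamily_le_of_sq_lt (by omega) (hm n) hY (by linarith)
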